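/- Rational functions are elements of $\mathbb{C}(z)$; the degree of $A=P/Q$ (in lowest terms) is $\max(\deg P,\deg Q)$, and $A^{\circ k}$ denotes the $k$-th iterate of $A$. For a rational function $F$ let $\Sigma(F)$ be the set of Möbius transformations $\sigma$ with $F\circ\sigma=F$, and put $\Sigma_\infty(A)=\bigcup_{k\ge 1}\Sigma(A^{\circ k})$. A rational function $\widetilde A$ is an elementary transformation of a nonconstant rational function $A$ if there exist rational functions $U,V$ with $A=U\circ V$ and $\widetilde A=V\circ U$; write $A\sim A'$ if there is a finite chain of elementary transformations between $A$ and $A'$. Theorem. Let $A$ be a rational function of degree $n\ge 2$. Then for every $\sigma\in\Sigma_\infty(A)$ the relation $A\circ\sigma\sim A$ holds. -/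

import Mathlib

namespace RationalFunction

/-- The degree of a rational function `P / Q` in lowest terms: `max (deg P) (deg Q)`. -/
noncomputable def degree (f : RatFunc ℂ) : ℕ :=
  max f.num.natDegree f.denom.natDegree

/-- The composition `f ∘ g`: the value of `f` at the element `g` of the field `ℂ(z)`.
For nonconstant `g` the denominator of `f` does not vanish at `g`, so this is the usual
composition; only compositions with a nonconstant inner function are used below. -/
noncomputable def comp (f g : RatFunc ℂ) : RatFunc ℂ :=
  RatFunc.eval RatFunc.C g f

/-- The iterates `f^{∘0} = z`, `f^{∘(k+1)} = f ∘ f^{∘k}`. -/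
noncomputable def iter (f : RatFunc ℂ) : ℕ → RatFunc ℂ
  | 0 => RatFunc.X
  | k + 1 => comp f (iter f k)

/-- Möbius transformations `(a z + b) / (c z + d)` with `a d - b c ≠ 0`. -/
def IsMobius (σ : RatFunc ℂ) : Prop :=
  ∃ a b c d : ℂ, a * d - b * c ≠ 0 ∧
    σ = (RatFunc.C a * RatFunc.X + RatFunc.C b) / (RatFunc.C c * RatFunc.X + RatFunc.C d)

/-- `Σ(A)`: the Möbius transformations `σ` with `A ∘ σ = A`. -/
def Sigma (A : RatFunc ℂ) : Set (RatFunc ℂ) :=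
  {σ | IsMobius σ ∧ comp A σ = A}

/-- `Σ_∞(A)`: the union of `Σ(A^{∘k})` over `k ≥ 1`. -/
def SigmaInfty (A : RatFunc ℂ) : Set (RatFunc ℂ) :=
  ⋃ k ≥ 1, Sigma (iter A k)

/-- `B` is an elementary transformation of `A`: `A = U ∘ V` and `B = V ∘ U` for some
rational functions `U`, `V`. These are taken nonconstant, as they must be if `A` is nonconstant. -/
def IsElementaryTransformation (A B : RatFunc ℂ) : Prop :=
  ∃ U V : RatFunc ℂ, 1 ≤ degree U ∧ 1 ≤ degree V ∧ A = comp U V ∧ B = comp V U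

/-- `A ∼ B`: there is a (finite, possibly empty) chain of elementary transformations
from `A` to `B`. -/
def Equivalent (A B : RatFunc ℂ) : Prop :=
  Relation.ReflTransGen IsElementaryTransformation A B

end RationalFunction

/-! Nonconstant rational functions under composition are the opposite of the monoid of `K`-algebra
endomorphisms of `K(z)`: `f` corresponds to the substitution `h ↦ h ∘ f`. If `A` and `σ` correspond
to `α` and `s`, then `A^{∘k} ∘ σ = A^{∘k}` reads `s * α ^ k = α ^ k`, so that `ξ = α ^ k`
intertwines `α` with `β = s * α`, the endomorphism of `A ∘ σ`.

Whenever `ξ * α = β * ξ` and `α ^ k = ω * ξ`, a chain of elementary transformations leads from `β`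
to `α`, by induction on the degree of `ξ`. Suppose first that the images of `ξ` and `β` generate
`K(z)`; then so do those of `ξ` and `β ^ k`. On the image `F` of `ξ` the maps `β ^ k` and `ξ * ω`
agree, so `β ^ k` preserves `F`. Applying it to the coefficients of the minimal polynomial of `z`
over `F` gives a polynomial with the root `β ^ k z`, which is its minimal polynomial since `z` and
`β ^ k z` both generate `K(z)` over `F`. But `ξ (ω z) ∈ F` is a root as well. Hence `F` is all of
`K(z)`, and `β` is conjugate to `α`. Otherwise, by Lüroth's theorem, `ξ = ν * ξ'` and `β = ν * β'`
with `ν` of degree at least two; then `β' * ν` is an elementary transformation of `β`, and `ξ'`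
intertwines `α` with it. -/

namespace RationalFunction

open Function IntermediateField Relation

/-- The monoid form of an elementary transformation: `a = u * v` and `b = v * u`. The order of the
factors is immaterial, so it applies to substitutions `f ↦ f ∘ g` as well as to the functions `g`
themselves. -/
def IsCyclicSwap {M : Type*} [Mul M] (a b : M) : Prop :=
  ∃ u v : M, a = u * v ∧ b = v * u

lemma IsCyclicSwap.of_semiconjBy {M : Type*} [Monoid M] {x a b : M} (hx : IsUnit x)
    (h : SemiconjBy x a b) : IsCyclicSwap b a := by
  obtain ⟨u, rfl⟩ := hx
  exact ⟨u * a, ↑u⁻¹, by rw [h.eq, Units.mul_inv_cancel_right],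
    (Units.inv_mul_cancel_left u a).symm⟩

lemma algebraMap_surjective_of_adjoin_eq_top {F L : Type*} [Field F] [Field L] [Algebra F L]
    (β : L →+* L) (γ : L →+* F)
    (hβγ : β.comp (algebraMap F L) = (algebraMap F L).comp (γ.comp (algebraMap F L)))
    {z : L} (hz : IsIntegral F z) (hz_top : F⟮z⟯ = ⊤) (hβz_top : F⟮β z⟯ = ⊤) :
    Surjective (algebraMap F L) := by
  set p := (minpoly F z).map (γ.comp (algebraMap F L)) with hp
  have hp_monic : p.Monic := (minpoly.monic hz).map _
  have hp_root : Polynomial.aeval (β z) p = 0 := by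
    rw [Polynomial.aeval_def, hp, Polynomial.eval₂_map, ← hβγ, ← Polynomial.hom_eval₂,
      ← Polynomial.aeval_def, minpoly.aeval, map_zero]
  have hβz : IsIntegral F (β z) := ⟨p, hp_monic, hp_root⟩
  have hp_minpoly : p = minpoly F (β z) := by
    refine Polynomial.eq_of_monic_of_dvd_of_natDegree_le (minpoly.monic hβz) hp_monic
      (minpoly.dvd F _ hp_root) (le_of_eq ?_)
    rw [hp, Polynomial.natDegree_map, ← adjoin.finrank hz, ← adjoin.finrank hβz, hz_top, hβz_top]
  have hγz : (minpoly F (β z)).IsRoot (γ z) := by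
    rw [← hp_minpoly, hp, Polynomial.IsRoot, Polynomial.eval_map, ← Polynomial.hom_eval₂,
      ← Polynomial.aeval_def, minpoly.aeval, map_zero]
  have hβz_mem : β z ∈ (⊥ : IntermediateField F L) := mem_bot.mpr ⟨_, minpoly.root hβz hγz⟩
  rw [← adjoin_simple_eq_bot_iff, hβz_top] at hβz_mem
  exact fun y ↦ mem_bot.mp (hβz_mem ▸ mem_top)

section FieldEndomorphisms

variable {K L : Type*} [Field K] [Field L] [Algebra K L]

lemma fieldRange_mul (φ ψ : L →ₐ[K] L) : (φ * ψ).fieldRange = ψ.fieldRange.map φ :=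
  (AlgHom.map_fieldRange ψ φ).symm

lemma fieldRange_mul_le (φ ψ : L →ₐ[K] L) : (φ * ψ).fieldRange ≤ φ.fieldRange := by
  rintro _ ⟨x, rfl⟩
  exact ⟨ψ x, rfl⟩

lemma isUnit_of_surjective {φ : L →ₐ[K] L} (hφ : Surjective φ) : IsUnit φ :=
  ⟨AlgEquiv.algHomUnitsEquiv K L |>.symm (AlgEquiv.ofBijective φ ⟨φ.injective, hφ⟩), rfl⟩

lemma finrank_fieldRange_mul (φ ψ : L →ₐ[K] L) :
    Module.finrank (φ * ψ).fieldRange L =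
      Module.finrank φ.fieldRange L * Module.finrank ψ.fieldRange L := by
  rw [← relfinrank_mul_finrank_top (fieldRange_mul_le φ ψ), fieldRange_mul,
    φ.fieldRange_eq_map, relfinrank_map_map, relfinrank_top_right, mul_comm]

lemma exists_eq_mul_of_fieldRange_le {φ ν : L →ₐ[K] L} (h : φ.fieldRange ≤ ν.fieldRange) :
    ∃ ψ, φ = ν * ψ :=
  ⟨ν.equivFieldRange.symm.toAlgHom.comp ((inclusion h).comp φ.rangeRestrict), AlgHom.ext fun x ↦
    congrArg Subtype.val (ν.equivFieldRange.apply_symm_apply ⟨φ x, h ⟨x, rfl⟩⟩).symm⟩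

lemma fieldRange_sup_fieldRange_pow_eq_top {ξ α β : L →ₐ[K] L} (h : SemiconjBy ξ α β)
    (hsup : ξ.fieldRange ⊔ β.fieldRange = ⊤) (k : ℕ) :
    ξ.fieldRange ⊔ (β ^ k).fieldRange = ⊤ := by
  induction k with
  | zero => exact top_le_iff.mp (le_sup_of_le_right fun x _ ↦ ⟨x, rfl⟩)
  | succ k ih =>
    have hβξ : (β * ξ).fieldRange ≤ ξ.fieldRange := h.eq ▸ fieldRange_mul_le ξ α
    have hβ : β.fieldRange = (β * ξ).fieldRange ⊔ (β ^ (k + 1)).fieldRange := by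
      rw [pow_succ', fieldRange_mul, fieldRange_mul, ← IntermediateField.map_sup, ih,
        β.fieldRange_eq_map]
    rw [← top_le_iff, ← hsup, hβ]
    exact sup_le le_sup_left (sup_le_sup_right hβξ _)

end FieldEndomorphisms

section RatFunc

variable {K : Type*} [Field K]

lemma fieldRange_eq_adjoin (φ : RatFunc K →ₐ[K] RatFunc K) :
    φ.fieldRange = K⟮φ RatFunc.X⟯ := by
  rw [φ.fieldRange_eq_map, ← RatFunc.adjoin_X, adjoin_map, Set.image_singleton]

lemma apply_X_ne_C (φ : RatFunc K →ₐ[K] RatFunc K) : ¬∃ c, φ RatFunc.X = RatFunc.C c := by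
  rintro ⟨c, hc⟩
  have hX : RatFunc.X = RatFunc.C c := φ.injective (hc.trans (φ.commutes c).symm)
  simpa using RatFunc.eq_C_iff _ |>.mp ⟨c, hX⟩

lemma fieldRange_ne_bot (φ : RatFunc K →ₐ[K] RatFunc K) : φ.fieldRange ≠ ⊥ := by
  rw [fieldRange_eq_adjoin, Ne, adjoin_simple_eq_bot_iff, mem_bot]
  exact fun ⟨c, hc⟩ ↦ apply_X_ne_C φ ⟨c, hc.symm⟩

lemma isIntegral_fieldRange_X (φ : RatFunc K →ₐ[K] RatFunc K) :
    IsIntegral φ.fieldRange (RatFunc.X : RatFunc K) :=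
  (RatFunc.IntermediateField.isAlgebraic_X (fieldRange_ne_bot φ)).isIntegral

lemma finrank_fieldRange_pos (φ : RatFunc K →ₐ[K] RatFunc K) :
    0 < Module.finrank φ.fieldRange (RatFunc K) := by
  rw [← finrank_top', ← RatFunc.IntermediateField.adjoin_X,
    adjoin.finrank (isIntegral_fieldRange_X φ)]
  exact minpoly.natDegree_pos (isIntegral_fieldRange_X φ)

lemma exists_fieldRange_eq {E : IntermediateField K (RatFunc K)} (hE : E ≠ ⊥) :
    ∃ ν : RatFunc K →ₐ[K] RatFunc K, ν.fieldRange = E :=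
  ⟨E.val.comp (RatFunc.Luroth.algEquiv hE).toAlgHom, by
    rw [← AlgHom.map_fieldRange, AlgEquiv.fieldRange_eq_top,
      ← AlgHom.fieldRange_eq_map, fieldRange_val]⟩

lemma surjective_of_semiconjBy {ξ ω β : RatFunc K →ₐ[K] RatFunc K} (h : SemiconjBy ξ (ω * ξ) β)
    (hsup : ξ.fieldRange ⊔ β.fieldRange = ⊤) : Surjective ξ := by
  have hadjoin : ξ.fieldRange⟮β RatFunc.X⟯ = ⊤ := by
    rw [← restrictScalars_eq_top_iff (K := K), restrictScalars_adjoin_eq_sup,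
      ← fieldRange_eq_adjoin, hsup]
  have hsurj : Surjective (algebraMap ξ.fieldRange (RatFunc K)) := by
    refine algebraMap_surjective_of_adjoin_eq_top (β : RatFunc K →+* RatFunc K)
      ((ξ.equivFieldRange.toAlgHom.comp ω : RatFunc K →ₐ[K] ξ.fieldRange) :
        RatFunc K →+* ξ.fieldRange) ?_ (isIntegral_fieldRange_X ξ)
      (RatFunc.IntermediateField.adjoin_X _) hadjoin
    ext ⟨_, y, rfl⟩
    exact (DFunLike.congr_fun h.eq y).symm
  intro y
  obtain ⟨⟨_, x, rfl⟩, hx⟩ := hsurj y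
  exact ⟨x, hx⟩

theorem reflTransGen_isCyclicSwap_of_semiconjBy {k : ℕ} {α β ξ ω : RatFunc K →ₐ[K] RatFunc K}
    (h : SemiconjBy ξ α β) (hα : α ^ k = ω * ξ) : ReflTransGen IsCyclicSwap β α := by
  induction hd : Module.finrank ξ.fieldRange (RatFunc K) using Nat.strong_induction_on
    generalizing ξ β ω with
  | _ d ih =>
  by_cases hξ : Surjective ξ
  · exact .single (.of_semiconjBy (isUnit_of_surjective hξ) h)
  have hsup : ξ.fieldRange ⊔ β.fieldRange ≠ ⊤ := fun hsup ↦ hξ <|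
    surjective_of_semiconjBy (hα ▸ h.pow_right k) (fieldRange_sup_fieldRange_pow_eq_top h hsup k)
  obtain ⟨ν, hν⟩ := exists_fieldRange_eq
    (ne_bot_of_le_ne_bot (fieldRange_ne_bot ξ) (le_sup_left (b := β.fieldRange)))
  obtain ⟨ξ', rfl⟩ := exists_eq_mul_of_fieldRange_le (le_sup_left.trans_eq hν.symm)
  obtain ⟨β', rfl⟩ := exists_eq_mul_of_fieldRange_le (le_sup_right.trans_eq hν.symm)
  have hlt : Module.finrank ξ'.fieldRange (RatFunc K) < d := by
    have hν_one : Module.finrank ν.fieldRange (RatFunc K) ≠ 1 := by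
      rwa [← relfinrank_top_right, Ne, relfinrank_eq_one_iff, top_le_iff, hν]
    rw [← hd, finrank_fieldRange_mul]
    have := finrank_fieldRange_pos ν
    exact lt_mul_of_one_lt_left (finrank_fieldRange_pos ξ') (by omega)
  have h' : SemiconjBy ξ' α (β' * ν) :=
    AlgHom.ext fun x ↦ ν.injective (DFunLike.congr_fun h.eq x)
  exact .head ⟨ν, β', rfl, rfl⟩ (ih _ hlt h' (by rw [hα, mul_assoc]) rfl)

end RatFunc

section Dictionary

variable (φ ψ : RatFunc ℂ →ₐ[ℂ] RatFunc ℂ)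

lemma algHom_apply_eq_comp (f : RatFunc ℂ) : φ f = comp f (φ RatFunc.X) := by
  have hpoly (p : Polynomial ℂ) : φ (algebraMap _ _ p) = p.eval₂ RatFunc.C (φ RatFunc.X) := by
    rw [← RatFunc.aeval_X_left_eq_algebraMap, ← Polynomial.aeval_algHom_apply]
    rfl
  rw [← RatFunc.num_div_denom f, map_div₀, hpoly, hpoly, RatFunc.num_div_denom]
  rfl

lemma mul_apply_X : (φ * ψ) RatFunc.X = comp (ψ RatFunc.X) (φ RatFunc.X) :=
  algHom_apply_eq_comp φ _

lemma pow_apply_X (k : ℕ) : (φ ^ k) RatFunc.X = iter (φ RatFunc.X) k := by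
  induction k with
  | zero => rfl
  | succ k ih => rw [pow_succ, mul_apply_X, ih, iter]

variable {φ ψ}

lemma algHom_ext (h : φ RatFunc.X = ψ RatFunc.X) : φ = ψ :=
  AlgHom.ext fun f ↦ by rw [algHom_apply_eq_comp, h, ← algHom_apply_eq_comp]

lemma one_le_degree_iff {f : RatFunc ℂ} : 1 ≤ degree f ↔ ¬∃ c, f = RatFunc.C c := by
  rw [RatFunc.eq_C_iff, degree]
  omega

lemma one_le_degree_apply_X : 1 ≤ degree (φ RatFunc.X) :=
  one_le_degree_iff.mpr (apply_X_ne_C φ)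

lemma exists_algHom_apply_X_eq {f : RatFunc ℂ} (hf : 1 ≤ degree f) :
    ∃ φ : RatFunc ℂ →ₐ[ℂ] RatFunc ℂ, φ RatFunc.X = f :=
  ⟨ℂ⟮f⟯.val.comp (RatFunc.algEquivOfTranscendental f
    (f.transcendental_of_ne_C (one_le_degree_iff.mp hf))).toAlgHom, by simp⟩

lemma exists_comp_C_eq_C (f : RatFunc ℂ) (c : ℂ) : ∃ d, comp f (RatFunc.C c) = RatFunc.C d :=
  ⟨f.num.eval c / f.denom.eval c, by
    rw [comp, RatFunc.eval, Polynomial.eval₂_at_apply, Polynomial.eval₂_at_apply, map_div₀]⟩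

lemma IsCyclicSwap.isElementaryTransformation (h : IsCyclicSwap φ ψ) :
    IsElementaryTransformation (φ RatFunc.X) (ψ RatFunc.X) := by
  obtain ⟨u, v, rfl, rfl⟩ := h
  exact ⟨v RatFunc.X, u RatFunc.X, one_le_degree_apply_X, one_le_degree_apply_X,
    mul_apply_X u v, mul_apply_X v u⟩

lemma equivalent_of_reflTransGen (h : ReflTransGen IsCyclicSwap φ ψ) :
    Equivalent (φ RatFunc.X) (ψ RatFunc.X) :=
  ReflTransGen.lift (fun χ : RatFunc ℂ →ₐ[ℂ] RatFunc ℂ ↦ χ RatFunc.X)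
    (fun _ _ ↦ IsCyclicSwap.isElementaryTransformation) _ _ h

lemma exists_algHom_of_mem_sigmaInfty {A σ : RatFunc ℂ} (hA : 1 ≤ degree A)
    (hσ : σ ∈ SigmaInfty A) : ∃ (α s : RatFunc ℂ →ₐ[ℂ] RatFunc ℂ) (k : ℕ),
      α RatFunc.X = A ∧ s RatFunc.X = σ ∧ s * α ^ k = α ^ k := by
  simp only [SigmaInfty, Set.mem_iUnion] at hσ
  obtain ⟨k, -, -, hσA⟩ := hσ
  obtain ⟨α, rfl⟩ := exists_algHom_apply_X_eq hA
  rw [← pow_apply_X] at hσA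
  have hσ_deg : 1 ≤ degree σ := by
    rw [one_le_degree_iff]
    rintro ⟨c, rfl⟩
    exact apply_X_ne_C (α ^ k) (hσA ▸ exists_comp_C_eq_C _ c)
  obtain ⟨s, rfl⟩ := exists_algHom_apply_X_eq hσ_deg
  exact ⟨α, s, k, rfl, rfl, algHom_ext ((mul_apply_X _ _).trans hσA)⟩

end Dictionary

end RationalFunction

open RationalFunction

theorem theorem5p2_general {K : Type*} [Field K] {α s : RatFunc K →ₐ[K] RatFunc K} {k : ℕ}
    (hs : s * α ^ k = α ^ k) : Relation.ReflTransGen IsCyclicSwap (s * α) α := by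
  have h : SemiconjBy (α ^ k) α (s * α) := by
    rw [SemiconjBy, mul_assoc, ← pow_succ', pow_succ, ← mul_assoc, hs]
  exact reflTransGen_isCyclicSwap_of_semiconjBy h (one_mul _).symm

theorem theorem5p2 (A : RatFunc ℂ) (hA : 2 ≤ RationalFunction.degree A)
    (σ : RatFunc ℂ) (hσ : σ ∈ RationalFunction.SigmaInfty A) :
    RationalFunction.Equivalent (RationalFunction.comp A σ) A := by
  obtain ⟨α, s, k, rfl, rfl, hs⟩ := exists_algHom_of_mem_sigmaInfty (by omega) hσ
  exact mul_apply_X s α ▸ equivalent_of_reflTransGen (theorem5p2_general hs)
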